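/- Let $S$ be a finite-dimensional algebra over a field $k$; "module" means finite-dimensional left $S$-module. Let $L(\lambda)$, $\lambda\in\Lambda^+$, be a full set of pairwise non-isomorphic simple modules, with projective covers $P(\lambda)$, and fix a partial order $\le$ on $\Lambda^+$. The standard module $\Delta(\lambda)$ is the largest quotient of $P(\lambda)$ all of whose composition factors are of the form $L(\mu)$ with $\mu\le\lambda$. Suppose that $S$ is quasi-hereditary, i.e. for every $\lambda$: (i) $L(\lambda)$ occurs exactly once as a composition factor of $\Delta(\lambda)$; (ii) $P(\lambda)$ has a filtration with sections of the form $\Delta(\mu)$ in which $\Delta(\lambda)$ occurs once, and if $\Delta(\mu)$ occurs then $\mu\ge\lambda$. For a non-zero module $X$ let the $\nabla$-filtration dimension $\mathrm{gfd}(X)$ be the number $d$ such that $\mathrm{Ext}_S^i(\Delta(\lambda),X)=0$ for all $i>d$ and all $\lambda$, while $\mathrm{Ext}_S^d(\Delta(\lambda),X)\ne 0$ for some $\lambda$ (put $\mathrm{gfd}(0)=-\infty$), and let $\mathrm{gfd}(S)=\sup_X \mathrm{gfd}(X)$ over all modules $X$. Suppose that there is a duality (contravariant self-equivalence) $X\mapsto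 X^\circ$ of the category of modules with $L(\lambda)^\circ\cong L(\lambda)$ for all $\lambda$, that strong property A holds, i.e. $\mu<\lambda$ implies $\mathrm{gfd}(L(\mu))<\mathrm{gfd}(L(\lambda))$, and that $\mathrm{gfd}(S)=n$ with $n\ge 0$ an integer. Then the global dimension of $S$, i.e. the supremum of the projective dimensions of its modules, equals $2n$. Moreover, for every module $Q$ with $\mathrm{gfd}(Q)=n$, $$\mathrm{Ext}_S^{2n}(Q^\circ,Q)\neq 0.$$ -/

import Mathlib

open CategoryTheory

universe u w

/-- The simple module `L` is a composition factor of the (finite length) module `M`: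
it is isomorphic to a subquotient `B / A` of `M`. -/
def IsCompositionFactor {S : Type u} [Ring S] (L M : Type u)
    [AddCommGroup L] [Module S L] [AddCommGroup M] [Module S M] : Prop :=
  ∃ A B : Submodule S M, A ≤ B ∧ Nonempty ((B ⧸ A.comap B.subtype) ≃ₗ[S] L)

/-- The simple module `L` occurs exactly once as a composition factor of `M`: every composition
series `0 = M₀ ⋖ M₁ ⋖ ⋯ ⋖ Mₗ = M` has exactly one section isomorphic to `L`.
(A module of finite length has a composition series, and by Jordan-Hölder the number of
sections isomorphic to `L` does not depend on it.) -/
def OccursOnce {S : Type u} [Ring S] (L M : Type u)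
    [AddCommGroup L] [Module S L] [AddCommGroup M] [Module S M] : Prop :=
  ∀ s : CompositionSeries (Submodule S M), s.head = ⊥ → s.last = ⊤ →
    ∃! i : Fin s.length,
      Nonempty ((s i.succ ⧸ (s i.castSucc).comap (s i.succ).subtype) ≃ₗ[S] L)

/-- A full set `L λ` of simple modules of a finite-dimensional algebra `S` up to isomorphism,
indexed without repetition by `Λ`, together with their projective covers `π λ : P λ → L λ`
(which exist for every finite-dimensional algebra and are unique up to isomorphism).
A module over a finite-dimensional algebra is finite-dimensional if and only if it is finitely
generated, so `FGModuleCat S` is the category of finite-dimensional (left) `S`-modules. -/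
structure SimplesWithCovers (S : Type u) [Ring S] (Λ : Type w) where
  /-- the simple modules -/
  L : Λ → FGModuleCat.{u} S
  simple_L : ∀ l, IsSimpleModule S (L l)
  eq_of_iso : ∀ l m, Nonempty (L l ≃ₗ[S] L m) → l = m
  exists_iso : ∀ M : FGModuleCat.{u} S, IsSimpleModule S M → ∃ l, Nonempty (M ≃ₗ[S] L l)
  /-- the indecomposable projective modules -/
  P : Λ → FGModuleCat.{u} S
  projective_P : ∀ l, Module.Projective S (P l)
  /-- the projective cover maps -/
  π : ∀ l, P l →ₗ[S] L l
  surjective_π : ∀ l, Function.Surjective (π l)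
  /-- the kernel of `π l` is superfluous -/
  superfluous_ker_π : ∀ l, ∀ N : Submodule S (P l), N ⊔ LinearMap.ker (π l) = ⊤ → N = ⊤

namespace SimplesWithCovers

variable {S : Type u} [Ring S] {Λ : Type w} [PartialOrder Λ] (D : SimplesWithCovers S Λ)

/-- The smallest submodule `U` of `P l` such that all composition factors of `P l / U`
are of the form `L m` with `m ≤ l`. -/
def standardKernel (l : Λ) : Submodule S (D.P l) :=
  sInf {U | ∀ m, IsCompositionFactor (S := S) (D.L m) (D.P l ⧸ U) → m ≤ l}

/-- The standard module `Δ l`: the largest quotient of `P l` all of whose composition factors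
are of the form `L m` with `m ≤ l`. -/
noncomputable def standard (l : Λ) : FGModuleCat.{u} S :=
  FGModuleCat.of S (D.P l ⧸ D.standardKernel l)

/-- `S` is quasi-hereditary with respect to the given partial order on the labels of the simple
modules. -/
structure IsQuasiHereditary : Prop where
  /-- `L l` occurs only once as a composition factor of `Δ l` -/
  occursOnce : ∀ l, OccursOnce (S := S) (D.L l) (D.standard l)
  /-- `P l` has a finite filtration with sections `Δ (ν i)`, in which `Δ l` occurs exactly once,
  and in which `Δ m` occurs only if `l ≤ m` -/
  filtration : ∀ l, ∃ (r : ℕ) (F : Fin (r + 1) → Submodule S (D.P l)) (ν : Fin r → Λ),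
    F 0 = ⊥ ∧ F (Fin.last r) = ⊤ ∧
    (∀ i : Fin r, F i.castSucc ≤ F i.succ) ∧
    (∀ i : Fin r, Nonempty
      ((F i.succ ⧸ (F i.castSucc).comap (F i.succ).subtype) ≃ₗ[S] D.standard (ν i))) ∧
    (∃! i : Fin r, ν i = l) ∧
    (∀ i : Fin r, l ≤ ν i)

/-- The `∇`-filtration dimension of a finite-dimensional module `X`: the least `d` such that
`Ext^i(Δ l, X) = 0` for all `i > d` and all `l`. For `X ≠ 0` this is the number `d` such that
`Ext^i(Δ l, X) = 0` for all `i > d` and all `l`, while `Ext^d(Δ l, X) ≠ 0` for some `l`.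
It is `⊥` for `X = 0`. -/
noncomputable def gfd (X : FGModuleCat.{u} S) : WithBot ℕ∞ :=
  sInf {d : WithBot ℕ∞ | ∀ i : ℕ, d < i → ∀ l : Λ,
    Subsingleton (Abelian.Ext (D.standard l).obj X.obj i)}

/-- The `∇`-filtration dimension of the algebra: the supremum of the `∇`-filtration dimensions
of its finite-dimensional modules. -/
noncomputable def gfdAlgebra : WithBot ℕ∞ :=
  ⨆ X : FGModuleCat.{u} S, D.gfd X

end SimplesWithCovers

/-- The global dimension of a finite-dimensional algebra: the supremum of the projective
dimensions of its finite-dimensional modules. -/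
noncomputable def globalDim (S : Type u) [Ring S] : WithBot ℕ∞ :=
  ⨆ X : FGModuleCat.{u} S, projectiveDimension X.obj

/-!
Let `d l` be the `∇`-filtration dimension of the simple module `L l`. By strong property A this is a
strictly monotone function from the labels to `{0, …, n}`, and nothing else about it is needed.

The radical of `Δ l` has composition factors `L m` with `m < l`, hence with `d m < d l`. Dimension
shifting along `0 → rad Δ l → Δ l → L l → 0` gives `Ext^i(L l, Y) = 0` for `i > d l + gfd Y`
(`extVanishes_L_left`), so all `Ext^i` with `i > 2n` vanish between finitely generated modules;
since syzygies are finitely generated, the global dimension is at most `2n`.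
Dually, `∇ l = (Δ l)°` satisfies `Ext^i(Δ m, ∇ l) = 0` for `i > 0` (`extVanishes_standard_dual`),
and shifting along `0 → L l → ∇ l → (rad Δ l)° → 0` shows that `Ext^i(Δ m, L l) ≠ 0` forces
`i + d m ≤ d l` (`extVanishes_L_right`).

Now let `gfd Q = n`, so that `Ext^n(Δ ν, Q) ≠ 0` for some `ν`. The last bound forces `d ν = 0`, so
`Δ ν = L ν`, and there is a non-zero `α` in `Ext^n(L ν, Q)`; by duality there is also a non-zero `x`
in `Ext^n(Q°, L ν)`. Their Yoneda product in `Ext^(2n)(Q°, Q)` is non-zero because multiplication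
with `α` is injective on `Ext^e(X, L ν)` whenever all composition factors `L l` of `X` have
`d l ≤ e` (`eq_zero_of_comp_eq_zero`). This goes by induction on `e`. For `e = 0` a map `X → L ν`
that is not zero splits. For the step, `X` is approximated by a direct sum `Y` of modules `Δ l` with
`d l = e`, up to a kernel and a cokernel whose composition factors have smaller `d`
(`exists_standard_approximation`); both `Ext^e(Y, L ν)` and `Ext^(n + e - 1)(Y, Q)` vanish, which
shifts the question to the kernel and lowers `e` by one.

Composition factors are handled through the support `{m | Hom(P m, X) ≠ 0}`, and `Ext` is compared
with its dual only as far as its vanishing is concerned (`extVanishes_dual_iff`).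
-/

/-! ### Vanishing of `Ext` between finitely generated modules -/

section ExtVanishing

variable {S : Type u} [Ring S]

/-- A short exact sequence `0 → A → B → C → 0` of finitely generated modules, in terms of the
underlying linear maps. -/
structure IsShortExact {A B C : FGModuleCat.{u} S} (f : A →ₗ[S] B) (g : B →ₗ[S] C) : Prop where
  injective : Function.Injective f
  exact : Function.Exact f g
  surjective : Function.Surjective g

/-- The vanishing of `Ext^i(X, Y)`, computed in the category of all `S`-modules. -/
abbrev ExtVanishes (X Y : FGModuleCat.{u} S) (i : ℕ) : Prop :=
  Subsingleton (Abelian.Ext X.obj Y.obj i)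

namespace IsShortExact

variable {A B C : FGModuleCat.{u} S} {f : A →ₗ[S] B} {g : B →ₗ[S] C}

/-- The short complex of modules underlying a short exact sequence of linear maps. -/
abbrev complex (h : IsShortExact f g) : ShortComplex (ModuleCat.{u} S) where
  X₁ := A.obj
  X₂ := B.obj
  X₃ := C.obj
  f := ModuleCat.ofHom f
  g := ModuleCat.ofHom g
  zero := by
    ext x
    exact h.exact.apply_apply_eq_zero x

lemma shortExact (h : IsShortExact f g) : h.complex.ShortExact where
  exact := (ShortComplex.ShortExact.moduleCat_exact_iff_function_exact _).mpr h.exact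
  mono_f := (ModuleCat.mono_iff_injective _).mpr h.injective
  epi_g := (ModuleCat.epi_iff_surjective _).mpr h.surjective

lemma ext_middle_left (h : IsShortExact f g) {Y : FGModuleCat.{u} S} {i : ℕ}
    (hA : ExtVanishes A Y i) (hC : ExtVanishes C Y i) : ExtVanishes B Y i := by
  refine subsingleton_of_forall_eq 0 fun x => ?_
  obtain ⟨y, rfl⟩ := Abelian.Ext.contravariant_sequence_exact₂ h.shortExact Y.obj x
    (@Subsingleton.elim _ hA _ _)
  rw [@Subsingleton.elim _ hC y 0, Abelian.Ext.comp_zero]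

lemma ext_right_left (h : IsShortExact f g) {Y : FGModuleCat.{u} S} {i : ℕ}
    (hA : ExtVanishes A Y i) (hB : ExtVanishes B Y (i + 1)) : ExtVanishes C Y (i + 1) := by
  refine subsingleton_of_forall_eq 0 fun x => ?_
  obtain ⟨y, rfl⟩ := Abelian.Ext.contravariant_sequence_exact₃ h.shortExact Y.obj x
    (@Subsingleton.elim _ hB _ _) (add_comm 1 i)
  rw [@Subsingleton.elim _ hA y 0, Abelian.Ext.comp_zero]

lemma ext_left_left (h : IsShortExact f g) {Y : FGModuleCat.{u} S} {i : ℕ}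
    (hB : ExtVanishes B Y i) (hC : ExtVanishes C Y (i + 1)) : ExtVanishes A Y i := by
  refine subsingleton_of_forall_eq 0 fun x => ?_
  obtain ⟨y, rfl⟩ := Abelian.Ext.contravariant_sequence_exact₁ h.shortExact Y.obj x
    (add_comm 1 i) (@Subsingleton.elim _ hC _ _)
  rw [@Subsingleton.elim _ hB y 0, Abelian.Ext.comp_zero]

lemma ext_middle_right (h : IsShortExact f g) {X : FGModuleCat.{u} S} {i : ℕ}
    (hA : ExtVanishes X A i) (hC : ExtVanishes X C i) : ExtVanishes X B i := by
  refine subsingleton_of_forall_eq 0 fun x => ?_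
  obtain ⟨y, rfl⟩ := Abelian.Ext.covariant_sequence_exact₂ X.obj h.shortExact x
    (@Subsingleton.elim _ hC _ _)
  rw [@Subsingleton.elim _ hA y 0, Abelian.Ext.zero_comp]

lemma ext_left_right (h : IsShortExact f g) {X : FGModuleCat.{u} S} {i : ℕ}
    (hC : ExtVanishes X C i) (hB : ExtVanishes X B (i + 1)) : ExtVanishes X A (i + 1) := by
  refine subsingleton_of_forall_eq 0 fun x => ?_
  obtain ⟨y, rfl⟩ := Abelian.Ext.covariant_sequence_exact₁ X.obj h.shortExact x
    (@Subsingleton.elim _ hB _ _) rfl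
  rw [@Subsingleton.elim _ hC y 0, Abelian.Ext.zero_comp]

lemma ext_right_right (h : IsShortExact f g) {X : FGModuleCat.{u} S} {i : ℕ}
    (hB : ExtVanishes X B i) (hA : ExtVanishes X A (i + 1)) : ExtVanishes X C i := by
  refine subsingleton_of_forall_eq 0 fun x => ?_
  obtain ⟨y, rfl⟩ := Abelian.Ext.covariant_sequence_exact₃ X.obj h.shortExact x rfl
    (@Subsingleton.elim _ hA _ _)
  rw [@Subsingleton.elim _ hB y 0, Abelian.Ext.zero_comp]

/-- If `Ext^1(B, Y) = 0`, then `Ext^1(C, Y)` is the cokernel of `Hom(B, Y) → Hom(A, Y)`. -/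
lemma ext_one_left_iff (h : IsShortExact f g) {Y : FGModuleCat.{u} S}
    (hB : ExtVanishes B Y 1) :
    ExtVanishes C Y 1 ↔ ∀ φ : A →ₗ[S] Y, ∃ ψ : B →ₗ[S] Y, ψ ∘ₗ f = φ := by
  constructor
  · intro hC φ
    obtain ⟨y, hy⟩ := Abelian.Ext.contravariant_sequence_exact₁ h.shortExact Y.obj
      (Abelian.Ext.mk₀ (ModuleCat.ofHom φ)) (add_zero 1) (@Subsingleton.elim _ hC _ _)
    obtain ⟨ψ, rfl⟩ := Abelian.Ext.homEquiv₀.symm.surjective y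
    refine ⟨ψ.hom, ?_⟩
    rw [Abelian.Ext.homEquiv₀_symm_apply, Abelian.Ext.mk₀_comp_mk₀] at hy
    exact congrArg ModuleCat.Hom.hom (Abelian.Ext.homEquiv₀.symm.injective hy)
  · intro hl
    refine subsingleton_of_forall_eq 0 fun x => ?_
    obtain ⟨y, rfl⟩ := Abelian.Ext.contravariant_sequence_exact₃ h.shortExact Y.obj x
      (@Subsingleton.elim _ hB _ _) (add_zero 1)
    obtain ⟨φ, rfl⟩ := Abelian.Ext.homEquiv₀.symm.surjective y
    obtain ⟨ψ, hψ⟩ := hl φ.hom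
    have : φ = h.complex.f ≫ ModuleCat.ofHom ψ := ModuleCat.hom_ext hψ.symm
    rw [this, Abelian.Ext.homEquiv₀_symm_apply, ← Abelian.Ext.mk₀_comp_mk₀,
      h.shortExact.extClass_comp_assoc]

/-- If `Ext^1(X, B) = 0`, then `Ext^1(X, A)` is the cokernel of `Hom(X, B) → Hom(X, C)`. -/
lemma ext_one_right_iff (h : IsShortExact f g) {X : FGModuleCat.{u} S}
    (hB : ExtVanishes X B 1) :
    ExtVanishes X A 1 ↔ ∀ φ : X →ₗ[S] C, ∃ ψ : X →ₗ[S] B, g ∘ₗ ψ = φ := by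
  constructor
  · intro hA φ
    obtain ⟨y, hy⟩ := Abelian.Ext.covariant_sequence_exact₃ X.obj h.shortExact
      (Abelian.Ext.mk₀ (ModuleCat.ofHom φ)) (zero_add 1) (@Subsingleton.elim _ hA _ _)
    obtain ⟨ψ, rfl⟩ := Abelian.Ext.homEquiv₀.symm.surjective y
    refine ⟨ψ.hom, ?_⟩
    rw [Abelian.Ext.homEquiv₀_symm_apply, Abelian.Ext.mk₀_comp_mk₀] at hy
    exact congrArg ModuleCat.Hom.hom (Abelian.Ext.homEquiv₀.symm.injective hy)
  · intro hl
    refine subsingleton_of_forall_eq 0 fun x => ?_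
    obtain ⟨y, rfl⟩ := Abelian.Ext.covariant_sequence_exact₁ X.obj h.shortExact x
      (@Subsingleton.elim _ hB _ _) (zero_add 1)
    obtain ⟨φ, rfl⟩ := Abelian.Ext.homEquiv₀.symm.surjective y
    obtain ⟨ψ, hψ⟩ := hl φ.hom
    have : φ = ModuleCat.ofHom ψ ≫ h.complex.g := ModuleCat.hom_ext hψ.symm
    rw [this, Abelian.Ext.homEquiv₀_symm_apply, ← Abelian.Ext.mk₀_comp_mk₀,
      Abelian.Ext.comp_assoc_of_second_deg_zero, h.shortExact.comp_extClass,
      Abelian.Ext.comp_zero]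

end IsShortExact

lemma extVanishes_zero_iff {X Y : FGModuleCat.{u} S} :
    ExtVanishes X Y 0 ↔ Subsingleton (X →ₗ[S] Y) :=
  (Abelian.Ext.homEquiv₀.trans ModuleCat.homEquiv).subsingleton_congr

lemma ExtVanishes.of_retract_left {X X' Y : FGModuleCat.{u} S} {i : ℕ}
    (f : X →ₗ[S] X') (g : X' →ₗ[S] X) (hgf : g ∘ₗ f = LinearMap.id)
    (h : ExtVanishes X' Y i) : ExtVanishes X Y i := by
  refine subsingleton_of_forall_eq 0 fun x => ?_
  have hid : 𝟙 X.obj = (ModuleCat.ofHom f : X.obj ⟶ X'.obj) ≫ ModuleCat.ofHom g :=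
    ModuleCat.hom_ext hgf.symm
  rw [← x.mk₀_id_comp, hid, ← Abelian.Ext.mk₀_comp_mk₀_assoc,
    @Subsingleton.elim _ h (Abelian.Ext.comp _ x _) 0, Abelian.Ext.comp_zero]

lemma ExtVanishes.of_retract_right {X Y Y' : FGModuleCat.{u} S} {i : ℕ}
    (f : Y →ₗ[S] Y') (g : Y' →ₗ[S] Y) (hgf : g ∘ₗ f = LinearMap.id)
    (h : ExtVanishes X Y' i) : ExtVanishes X Y i := by
  refine subsingleton_of_forall_eq 0 fun x => ?_
  have hid : 𝟙 Y.obj = (ModuleCat.ofHom f : Y.obj ⟶ Y'.obj) ≫ ModuleCat.ofHom g :=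
    ModuleCat.hom_ext hgf.symm
  rw [← x.comp_mk₀_id, hid, ← Abelian.Ext.mk₀_comp_mk₀,
    ← Abelian.Ext.comp_assoc_of_second_deg_zero,
    @Subsingleton.elim _ h (Abelian.Ext.comp x _ _) 0, Abelian.Ext.zero_comp]

lemma ExtVanishes.congr_left {X X' Y : FGModuleCat.{u} S} {i : ℕ} (e : X ≃ₗ[S] X') :
    ExtVanishes X Y i ↔ ExtVanishes X' Y i :=
  ⟨fun h => h.of_retract_left e.symm.toLinearMap e.toLinearMap (by ext; simp),
    fun h => h.of_retract_left e.toLinearMap e.symm.toLinearMap (by ext; simp)⟩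

lemma ExtVanishes.congr_right {X Y Y' : FGModuleCat.{u} S} {i : ℕ} (e : Y ≃ₗ[S] Y') :
    ExtVanishes X Y i ↔ ExtVanishes X Y' i :=
  ⟨fun h => h.of_retract_right e.symm.toLinearMap e.toLinearMap (by ext; simp),
    fun h => h.of_retract_right e.toLinearMap e.symm.toLinearMap (by ext; simp)⟩

lemma extVanishes_of_subsingleton_left {X Y : FGModuleCat.{u} S} [Subsingleton X] (i : ℕ) :
    ExtVanishes X Y i := by
  refine subsingleton_of_forall_eq 0 fun x => ?_
  have hid : 𝟙 X.obj = 0 := ModuleCat.hom_ext (LinearMap.ext fun _ => Subsingleton.elim _ _)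
  rw [← x.mk₀_id_comp, hid, Abelian.Ext.mk₀_zero, Abelian.Ext.zero_comp]

lemma extVanishes_of_subsingleton_right {X Y : FGModuleCat.{u} S} [Subsingleton Y] (i : ℕ) :
    ExtVanishes X Y i := by
  refine subsingleton_of_forall_eq 0 fun x => ?_
  have hid : 𝟙 Y.obj = 0 := ModuleCat.hom_ext (LinearMap.ext fun _ => Subsingleton.elim _ _)
  rw [← x.comp_mk₀_id, hid, Abelian.Ext.mk₀_zero, Abelian.Ext.comp_zero]

lemma extVanishes_of_projective {X Y : FGModuleCat.{u} S} [Module.Projective S X] (i : ℕ) :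
    ExtVanishes X Y (i + 1) :=
  have : Projective X.obj := (IsProjective.iff_projective X.obj.carrier).mp ‹_›
  Abelian.Ext.subsingleton_of_projective _ _ _

variable [IsNoetherianRing S]

lemma isShortExact_submodule {B : FGModuleCat.{u} S} (N : Submodule S B) :
    IsShortExact (A := FGModuleCat.of S N) (B := B) (C := FGModuleCat.of S (B ⧸ N))
      N.subtype N.mkQ where
  injective := N.subtype_injective
  exact := LinearMap.exact_subtype_mkQ N
  surjective := N.mkQ_surjective

lemma isShortExact_ker {B C : FGModuleCat.{u} S} {g : B →ₗ[S] C} (hg : Function.Surjective g) :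
    IsShortExact (A := FGModuleCat.of S (LinearMap.ker g)) (LinearMap.ker g).subtype g where
  injective := Submodule.subtype_injective _
  exact := LinearMap.exact_subtype_ker_map g
  surjective := hg

lemma exists_projective_presentation (X : FGModuleCat.{u} S) :
    ∃ (A P : FGModuleCat.{u} S) (f : A →ₗ[S] P) (g : P →ₗ[S] X),
      Module.Projective S P ∧ IsShortExact f g := by
  obtain ⟨n, g, hg⟩ := Module.Finite.exists_fin' S X
  exact ⟨_, FGModuleCat.of S (Fin n → S), _, g, inferInstanceAs (Module.Projective S (Fin n → S)),
    isShortExact_ker hg⟩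

/-- A finitely generated module has projective dimension less than `m + 1` as soon as
`Ext^(m + 1)` vanishes against finitely generated modules: its syzygies are finitely generated. -/
lemma hasProjectiveDimensionLT_of_extVanishes (m : ℕ) :
    ∀ X : FGModuleCat.{u} S, (∀ Y : FGModuleCat.{u} S, ExtVanishes X Y (m + 1)) →
      HasProjectiveDimensionLT X.obj (m + 1) := by
  induction m with
  | zero =>
    intro X hX
    obtain ⟨A, P, f, g, hP, h⟩ := exists_projective_presentation X
    obtain ⟨ψ, hψ⟩ := (h.ext_one_left_iff (extVanishes_of_projective 0)).mp (hX A) LinearMap.id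
    have hsplit : (∃ s, g ∘ₗ s = LinearMap.id) ↔ ∃ r, r ∘ₗ f = LinearMap.id :=
      (h.exact.split_tfae h.injective h.surjective).out 0 1
    obtain ⟨s, hs⟩ := hsplit.mpr ⟨ψ, hψ⟩
    have : Module.Projective S X := Module.Projective.of_split s g hs
    exact projective_iff_hasProjectiveDimensionLT_one.mp
      ((IsProjective.iff_projective X.obj.carrier).mp this)
  | succ m ih =>
    intro X hX
    obtain ⟨A, P, f, g, hP, h⟩ := exists_projective_presentation X
    have hA := ih A fun Y => h.ext_left_left (extVanishes_of_projective m) (hX Y)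
    exact (h.shortExact.hasProjectiveDimensionLT_X₃_iff m
      ((IsProjective.iff_projective P.obj.carrier).mp hP)).mpr hA

end ExtVanishing

/-! ### Composition factors and dévissage -/

namespace SimplesWithCovers

variable {S : Type u} [Ring S] {Λ : Type w} (D : SimplesWithCovers S Λ)

/-- The support of a module: the labels `m` such that `L m` is a composition factor. Since `P m` is
the projective cover of `L m`, this is the same as a non-zero homomorphism from `P m`. -/
def supp (X : Type u) [AddCommGroup X] [Module S X] : Set Λ :=
  {m | ∃ φ : D.P m →ₗ[S] X, φ ≠ 0}

section

variable {X Y Z : Type u} [AddCommGroup X] [Module S X] [AddCommGroup Y] [Module S Y]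
  [AddCommGroup Z] [Module S Z]

lemma eq_zero_of_notMem_supp {m : Λ} (h : m ∉ D.supp X) (φ : D.P m →ₗ[S] X) : φ = 0 := by
  by_contra h0
  exact h ⟨φ, h0⟩

lemma supp_subset_of_injective {f : X →ₗ[S] Y} (hf : Function.Injective f) :
    D.supp X ⊆ D.supp Y := by
  rintro m ⟨φ, hφ⟩
  refine ⟨f ∘ₗ φ, fun h => hφ (LinearMap.ext fun x => hf ?_)⟩
  simpa using LinearMap.congr_fun h x

lemma supp_subset_of_surjective {f : X →ₗ[S] Y} (hf : Function.Surjective f) :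
    D.supp Y ⊆ D.supp X := by
  rintro m ⟨φ, hφ⟩
  have := D.projective_P m
  obtain ⟨ψ, hψ⟩ := Module.projective_lifting_property f φ hf
  refine ⟨ψ, fun h => hφ ?_⟩
  rw [← hψ, h, LinearMap.comp_zero]

lemma supp_subset_union {f : X →ₗ[S] Y} {g : Y →ₗ[S] Z} (hf : Function.Injective f)
    (hfg : Function.Exact f g) : D.supp Y ⊆ D.supp X ∪ D.supp Z := by
  rintro m ⟨φ, hφ⟩
  by_contra hm
  rw [Set.mem_union, not_or] at hm
  have hz : g ∘ₗ φ = 0 := D.eq_zero_of_notMem_supp hm.2 _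
  -- `φ` takes values in the image of `X`
  let e := LinearEquiv.ofInjective f hf
  have hr : ∀ x, φ x ∈ LinearMap.range f := fun x =>
    (hfg (φ x)).mp (by simpa using LinearMap.congr_fun hz x)
  have h0 := D.eq_zero_of_notMem_supp hm.1 (e.symm.toLinearMap ∘ₗ φ.codRestrict _ hr)
  refine hφ (LinearMap.ext fun x => ?_)
  have h1 : e.symm ⟨φ x, hr x⟩ = 0 := LinearMap.congr_fun h0 x
  simpa using h1

lemma supp_congr (e : X ≃ₗ[S] Y) : D.supp X = D.supp Y :=
  (D.supp_subset_of_injective e.injective).antisymm (D.supp_subset_of_surjective e.surjective)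

lemma supp_eq_empty [Subsingleton X] : D.supp X = ∅ := by
  refine Set.eq_empty_of_forall_notMem ?_
  rintro m ⟨φ, hφ⟩
  exact hφ (LinearMap.ext fun _ => Subsingleton.elim _ _)

end

lemma π_ne_zero (l : Λ) : D.π l ≠ 0 := by
  intro h
  have := D.simple_L l
  have := IsSimpleModule.nontrivial S (D.L l)
  obtain ⟨x, hx⟩ := exists_ne (0 : D.L l)
  obtain ⟨y, rfl⟩ := D.surjective_π l x
  exact hx (by simp [h])

/-- Every proper submodule of `P l` lies in the kernel of `π l`. -/
lemma le_ker_π {l : Λ} {N : Submodule S (D.P l)} (hN : N ≠ ⊤) : N ≤ LinearMap.ker (D.π l) := by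
  have := D.simple_L l
  have hco : IsCoatom (LinearMap.ker (D.π l)) :=
    LinearMap.isCoatom_ker_of_surjective (D.surjective_π l)
  by_contra h
  refine hN (D.superfluous_ker_π l N ?_)
  rw [sup_comm]
  exact hco.2 _ (by simpa using h)

lemma eq_of_mem_supp_L {m l : Λ} (h : m ∈ D.supp (D.L l)) : m = l := by
  obtain ⟨φ, hφ⟩ := h
  have := D.simple_L l
  have := D.simple_L m
  have hs : Function.Surjective φ := LinearMap.surjective_of_ne_zero hφ
  have hk : LinearMap.ker φ = LinearMap.ker (D.π m) := by
    have hc := LinearMap.isCoatom_ker_of_surjective hs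
    have hc' := LinearMap.isCoatom_ker_of_surjective (D.surjective_π m)
    exact (hc.le_iff_eq hc'.1).mp (D.le_ker_π hc.1) |>.symm
  exact D.eq_of_iso m l ⟨(LinearMap.quotKerEquivOfSurjective _ (D.surjective_π m)).symm ≪≫ₗ
    Submodule.quotEquivOfEq _ _ hk.symm ≪≫ₗ LinearMap.quotKerEquivOfSurjective _ hs⟩

lemma mem_supp_L (l : Λ) : l ∈ D.supp (D.L l) := ⟨D.π l, D.π_ne_zero l⟩

lemma mem_supp_of_isCompositionFactor {m : Λ} {X : Type u} [AddCommGroup X] [Module S X]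
    (h : IsCompositionFactor (S := S) (D.L m) X) : m ∈ D.supp X := by
  obtain ⟨A, B, -, ⟨e⟩⟩ := h
  have h1 := D.mem_supp_L m
  rw [← D.supp_congr e] at h1
  exact D.supp_subset_of_injective B.subtype_injective
    (D.supp_subset_of_surjective (Submodule.mkQ_surjective _) h1)

lemma isCompositionFactor_of_mem_supp {m : Λ} {X : Type u} [AddCommGroup X] [Module S X]
    (h : m ∈ D.supp X) : IsCompositionFactor (S := S) (D.L m) X := by
  obtain ⟨φ, hφ⟩ := h
  -- the image of `φ` has `L m` as a quotient
  have hle : LinearMap.ker φ ≤ LinearMap.ker (D.π m) :=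
    D.le_ker_π fun h => hφ (LinearMap.ker_eq_top.mp h)
  let θ : LinearMap.range φ →ₗ[S] D.L m :=
    (LinearMap.ker φ).liftQ (D.π m) hle ∘ₗ φ.quotKerEquivRange.symm.toLinearMap
  have hθ : Function.Surjective θ := by
    intro y
    obtain ⟨x, rfl⟩ := D.surjective_π m y
    exact ⟨φ.quotKerEquivRange (Submodule.Quotient.mk x), by simp [θ]⟩
  refine ⟨(LinearMap.ker θ).map (LinearMap.range φ).subtype, LinearMap.range φ,
    Submodule.map_subtype_le _ _, ⟨?_⟩⟩
  exact Submodule.quotEquivOfEq _ _ (Submodule.comap_map_eq_of_injective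
    (Submodule.subtype_injective _) _) ≪≫ₗ LinearMap.quotKerEquivOfSurjective _ hθ

variable [IsNoetherianRing S] [IsArtinianRing S]

/-- Dévissage: a property of finitely generated modules that is stable under extensions and holds
for the zero module holds for `X` once it holds for the composition factors of `X`. -/
theorem devissage {motive : FGModuleCat.{u} S → Prop}
    (zero : ∀ X : FGModuleCat.{u} S, Subsingleton X → motive X)
    (extension : ∀ {A B C : FGModuleCat.{u} S} (f : A →ₗ[S] B) (g : B →ₗ[S] C),
      IsShortExact f g → motive A → motive C → motive B)
    (X : FGModuleCat.{u} S) (simple : ∀ l ∈ D.supp X, motive (D.L l)) : motive X := by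
  have congr : ∀ {A B : FGModuleCat.{u} S}, (A ≃ₗ[S] B) → motive A → motive B := by
    intro A B e hA
    have : Subsingleton (FGModuleCat.of S PUnit.{u + 1}) := inferInstanceAs (Subsingleton PUnit)
    refine extension (C := FGModuleCat.of S PUnit) e.toLinearMap 0
      ⟨e.injective, fun y => ⟨fun _ => e.surjective y, fun _ => rfl⟩,
        fun _ => ⟨0, Subsingleton.elim _ _⟩⟩ hA (zero _ this)
  -- a maximal submodule with the property is everything, as it could be enlarged by a simple one
  obtain ⟨N, hN, hmax⟩ := WellFounded.has_min (wellFounded_gt (α := Submodule S X))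
    {N | motive (FGModuleCat.of S N)}
    ⟨⊥, zero _ (inferInstanceAs (Subsingleton (⊥ : Submodule S X)))⟩
  have htop : N = ⊤ := by
    by_contra hne
    have : Nontrivial (X ⧸ N) := Submodule.Quotient.nontrivial_iff.mpr hne
    obtain ⟨T, hT⟩ := IsAtomic.exists_atom (Submodule S (X ⧸ N))
    have hTs : IsSimpleModule S T := isSimpleModule_iff_isAtom.mpr hT
    obtain ⟨l, ⟨e⟩⟩ := D.exists_iso (FGModuleCat.of S T) hTs
    have hl : l ∈ D.supp X := by
      refine D.supp_subset_of_surjective N.mkQ_surjective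
        (D.supp_subset_of_injective T.subtype_injective ?_)
      have := D.mem_supp_L l
      rwa [← D.supp_congr e] at this
    have hle : N ≤ T.comap N.mkQ := fun x hx => by
      simp [(Submodule.Quotient.mk_eq_zero N).mpr hx]
    let g : T.comap N.mkQ →ₗ[S] T := N.mkQ.restrict fun x hx => hx
    have hB : motive (FGModuleCat.of S (T.comap N.mkQ)) := by
      refine extension (A := FGModuleCat.of S N) (C := FGModuleCat.of S T)
        (Submodule.inclusion hle) g ⟨Submodule.inclusion_injective hle, ?_, ?_⟩ hN
        (congr e.symm (simple l hl))
      · intro y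
        constructor
        · intro hy
          have : N.mkQ y.1 = 0 := congrArg Subtype.val hy
          exact ⟨⟨y.1, (Submodule.Quotient.mk_eq_zero N).mp this⟩, rfl⟩
        · rintro ⟨x, rfl⟩
          exact Subtype.ext ((Submodule.Quotient.mk_eq_zero N).mpr x.2)
      · rintro ⟨t, ht⟩
        obtain ⟨x, rfl⟩ := N.mkQ_surjective t
        exact ⟨⟨x, ht⟩, rfl⟩
    refine hmax _ hB (lt_of_le_of_ne hle fun h => hT.1 ?_)
    rw [eq_bot_iff]
    intro t ht
    obtain ⟨x, rfl⟩ := N.mkQ_surjective t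
    have : x ∈ N := h ▸ ht
    exact (Submodule.Quotient.mk_eq_zero N).mpr this
  subst htop
  exact congr Submodule.topEquiv hN

lemma extVanishes_left_of_supp {X Y : FGModuleCat.{u} S} {i : ℕ}
    (h : ∀ l ∈ D.supp X, ExtVanishes (D.L l) Y i) : ExtVanishes X Y i :=
  D.devissage (motive := fun X => ExtVanishes X Y i)
    (fun _ _ => extVanishes_of_subsingleton_left i)
    (fun _ _ h hA hC => h.ext_middle_left hA hC) X h

lemma extVanishes_right_of_supp {X Y : FGModuleCat.{u} S} {i : ℕ}
    (h : ∀ l ∈ D.supp Y, ExtVanishes X (D.L l) i) : ExtVanishes X Y i :=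
  D.devissage (motive := fun Y => ExtVanishes X Y i)
    (fun _ _ => extVanishes_of_subsingleton_right i)
    (fun _ _ h hA hC => h.ext_middle_right hA hC) Y h

lemma subsingleton_of_supp_eq_empty {X : FGModuleCat.{u} S} (h : D.supp X = ∅) :
    Subsingleton X :=
  D.devissage (motive := fun X => Subsingleton X) (fun _ h => h)
    (fun f g h hA hC => subsingleton_of_forall_eq 0 fun y => by
      obtain ⟨x, rfl⟩ := (h.exact y).mp (Subsingleton.elim _ _)
      rw [Subsingleton.elim x 0, map_zero]) X (by simp [h])

end SimplesWithCovers

/-! ### Dualities -/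

section Duality

open Opposite

variable {S : Type u} [Ring S]

/-- A contravariant self-equivalence of the category of finitely generated `S`-modules. -/
abbrev ModuleDuality (S : Type u) [Ring S] := (FGModuleCat.{u} S)ᵒᵖ ≌ FGModuleCat.{u} S

namespace ModuleDuality

variable (F : ModuleDuality S)

/-- The dual `X°` of a module. -/
abbrev dualObj (X : FGModuleCat.{u} S) : FGModuleCat.{u} S := F.functor.obj (op X)

/-- The dual `f° : Y° → X°` of a linear map `f : X → Y`. -/
def dualMap {X Y : FGModuleCat.{u} S} (f : X →ₗ[S] Y) : F.dualObj Y →ₗ[S] F.dualObj X :=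
  (F.functor.map (FGModuleCat.ofHom f : X ⟶ Y).op).hom.hom

lemma dualMap_comp {X Y Z : FGModuleCat.{u} S} (f : X →ₗ[S] Y) (g : Y →ₗ[S] Z) :
    F.dualMap (g ∘ₗ f) = F.dualMap f ∘ₗ F.dualMap g := by
  have : (FGModuleCat.ofHom (g ∘ₗ f) : X ⟶ Z) =
    (FGModuleCat.ofHom f : X ⟶ Y) ≫ (FGModuleCat.ofHom g : Y ⟶ Z) := rfl
  unfold dualMap
  rw [this, op_comp, Functor.map_comp]
  rfl

lemma dualMap_bijective {X Y : FGModuleCat.{u} S} :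
    Function.Bijective (F.dualMap : (X →ₗ[S] Y) → _) := by
  constructor
  · intro f g h
    have h1 := F.functor.map_injective (FGModuleCat.hom_ext h)
    exact congrArg (fun k : X ⟶ Y => k.hom.hom) (Quiver.Hom.op_inj h1)
  · intro φ
    obtain ⟨k, hk⟩ := F.functor.map_surjective (FGModuleCat.ofHom φ : F.dualObj Y ⟶ F.dualObj X)
    exact ⟨k.unop.hom.hom, congrArg (fun k : F.dualObj Y ⟶ F.dualObj X => k.hom.hom) hk⟩

/-- The inverse of a duality, again as a duality. -/
def inv : ModuleDuality S := F.symm.leftOp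

lemma nonempty_dual_inv (X : FGModuleCat.{u} S) :
    Nonempty (F.dualObj (F.inv.dualObj X) ≃ₗ[S] X) :=
  ⟨FGModuleCat.isoToLinearEquiv (F.counitIso.app X)⟩

lemma nonempty_inv_dual (X : FGModuleCat.{u} S) :
    Nonempty (F.inv.dualObj (F.dualObj X) ≃ₗ[S] X) :=
  ⟨FGModuleCat.isoToLinearEquiv (F.unitIso.app (op X)).unop⟩

lemma nonempty_dual_congr {X Y : FGModuleCat.{u} S} (e : X ≃ₗ[S] Y) :
    Nonempty (F.dualObj X ≃ₗ[S] F.dualObj Y) :=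
  ⟨FGModuleCat.isoToLinearEquiv (F.functor.mapIso (e.symm.toFGModuleCatIso : Y ≅ X).op)⟩

lemma subsingleton_dual (X : FGModuleCat.{u} S) [Subsingleton X] : Subsingleton (F.dualObj X) := by
  have h : Subsingleton (F.dualObj X →ₗ[S] F.dualObj X) :=
    (Equiv.ofBijective _ (F.dualMap_bijective (X := X) (Y := X))).symm.subsingleton
  exact subsingleton_of_forall_eq 0 fun x =>
    LinearMap.congr_fun (Subsingleton.elim (LinearMap.id : F.dualObj X →ₗ[S] _) 0) x

variable [IsNoetherianRing S]

lemma isShortExact_dual {A B C : FGModuleCat.{u} S} {f : A →ₗ[S] B} {g : B →ₗ[S] C}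
    (h : IsShortExact f g) : IsShortExact (F.dualMap g) (F.dualMap f) := by
  let T : ShortComplex (FGModuleCat.{u} S) :=
    { X₁ := A, X₂ := B, X₃ := C, f := FGModuleCat.ofHom f, g := FGModuleCat.ofHom g
      zero := by
        ext x
        exact h.exact.apply_apply_eq_zero x }
  let U := forget₂ (FGModuleCat.{u} S) (ModuleCat.{u} S)
  have hT : T.ShortExact := by
    have hU : (T.map U).ShortExact := h.shortExact
    have h1 : T.Exact := (ShortComplex.exact_map_iff_of_faithful T U).mp hU.exact
    have h2 : Mono T.f := U.mono_of_mono_map hU.mono_f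
    have h3 : Epi T.g := U.epi_of_epi_map hU.epi_g
    exact ⟨h1⟩
  have hF : ((T.op.map F.functor).map U).ShortExact := (hT.op.map_of_exact F.functor).map_of_exact U
  exact ⟨(ModuleCat.mono_iff_injective _).mp hF.mono_f,
    (ShortComplex.ShortExact.moduleCat_exact_iff_function_exact _).mp hF.exact,
    (ModuleCat.epi_iff_surjective _).mp hF.epi_g⟩

lemma surjective_of_injective_dualMap {X Y : FGModuleCat.{u} S} {f : X →ₗ[S] Y}
    (hf : Function.Injective (F.dualMap f)) : Function.Surjective f := by
  let U := forget₂ (FGModuleCat.{u} S) (ModuleCat.{u} S)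
  let f' : X ⟶ Y := FGModuleCat.ofHom f
  have h1 : Mono (F.functor.map f'.op) :=
    U.mono_of_mono_map ((ModuleCat.mono_iff_injective _).mpr hf)
  have h2 : Mono f'.op := F.functor.mono_of_mono_map h1
  have h3 : Epi f' := unop_epi_of_mono f'.op
  exact (ModuleCat.epi_iff_surjective (U.map f')).mp inferInstance

/-- The dual of a projective module is injective relative to finitely generated modules. -/
lemma extVanishes_dual_of_projective {P : FGModuleCat.{u} S} [Module.Projective S P] (i : ℕ) :
    ∀ X : FGModuleCat.{u} S, ExtVanishes X (F.dualObj P) (i + 1) := by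
  induction i with
  | zero =>
    intro X
    obtain ⟨A, R, f, g, hR, h⟩ := exists_projective_presentation X
    rw [zero_add, h.ext_one_left_iff (extVanishes_of_projective 0)]
    intro φ
    -- up to `F (F⁻¹ Y) ≃ Y`, the maps `f` and `φ` are the duals of a surjection `F⁻¹ R → F⁻¹ A`
    -- and of a map `P → F⁻¹ A`, which lifts along it
    obtain ⟨a⟩ := F.nonempty_dual_inv A
    obtain ⟨r⟩ := F.nonempty_dual_inv R
    obtain ⟨f', hf'⟩ := F.dualMap_bijective.2
      (r.symm.toLinearMap ∘ₗ f ∘ₗ a.toLinearMap : F.dualObj (F.inv.dualObj A) →ₗ[S] _)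
    obtain ⟨φ', hφ'⟩ := F.dualMap_bijective.2
      (φ ∘ₗ a.toLinearMap : F.dualObj (F.inv.dualObj A) →ₗ[S] _)
    have hs : Function.Surjective f' := by
      refine F.surjective_of_injective_dualMap ?_
      rw [hf']
      exact r.symm.injective.comp (h.injective.comp a.injective)
    obtain ⟨ψ', hψ'⟩ := Module.projective_lifting_property f' φ' hs
    refine ⟨F.dualMap ψ' ∘ₗ r.symm.toLinearMap, LinearMap.ext fun x => ?_⟩
    have h1 := F.dualMap_comp ψ' f'
    rw [hψ', hφ', hf'] at h1
    have h2 := LinearMap.congr_fun h1 (a.symm x)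
    simpa using h2.symm
  | succ i ih =>
    intro X
    obtain ⟨A, R, f, g, hR, h⟩ := exists_projective_presentation X
    exact h.ext_right_left (ih A) (extVanishes_of_projective _)

/-- `Ext^i(X, Y)` vanishes if and only if `Ext^i(Y°, X°)` does. -/
theorem extVanishes_dual_iff (i : ℕ) : ∀ X Y : FGModuleCat.{u} S,
    ExtVanishes (F.dualObj Y) (F.dualObj X) i ↔ ExtVanishes X Y i := by
  induction i with
  | zero =>
    intro X Y
    rw [extVanishes_zero_iff, extVanishes_zero_iff]
    exact (Equiv.ofBijective _ (F.dualMap_bijective (X := X) (Y := Y))).symm.subsingleton_congr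
  | succ i ih =>
    intro X Y
    obtain ⟨A, R, f, g, hR, h⟩ := exists_projective_presentation X
    have h' := F.isShortExact_dual h
    cases i with
    | zero =>
      rw [zero_add, h.ext_one_left_iff (extVanishes_of_projective 0),
        h'.ext_one_right_iff (F.extVanishes_dual_of_projective 0 _)]
      rw [F.dualMap_bijective.2.forall]
      refine forall_congr' fun φ => ?_
      rw [F.dualMap_bijective.2.exists]
      refine exists_congr fun ψ => ?_
      rw [← F.dualMap_comp, F.dualMap_bijective.1.eq_iff]
    | succ i =>
      have h1 : ExtVanishes X Y (i + 1 + 1) ↔ ExtVanishes A Y (i + 1) :=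
        ⟨fun hX => h.ext_left_left (extVanishes_of_projective i) hX,
          fun hA => h.ext_right_left hA (extVanishes_of_projective (i + 1))⟩
      have h2 : ExtVanishes (F.dualObj Y) (F.dualObj X) (i + 1 + 1) ↔
          ExtVanishes (F.dualObj Y) (F.dualObj A) (i + 1) :=
        ⟨fun hX => h'.ext_right_right (F.extVanishes_dual_of_projective i _) hX,
          fun hA => h'.ext_left_right hA (F.extVanishes_dual_of_projective (i + 1) _)⟩
      rw [h1, h2, ih]

end ModuleDuality

end Duality

namespace SimplesWithCovers

variable {S : Type u} [Ring S] {Λ : Type w} (D : SimplesWithCovers S Λ)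

/-- The duality fixes the simple modules up to isomorphism. -/
def FixedBy (F : ModuleDuality S) : Prop :=
  ∀ l, Nonempty (F.dualObj (D.L l) ≃ₗ[S] D.L l)

variable {D} {F : ModuleDuality S}

lemma FixedBy.inv (hF : D.FixedBy F) : D.FixedBy F.inv := fun l => by
  obtain ⟨e⟩ := hF l
  obtain ⟨e'⟩ := F.inv.nonempty_dual_congr e
  obtain ⟨e''⟩ := F.nonempty_inv_dual (D.L l)
  exact ⟨e'.symm ≪≫ₗ e''⟩

variable [IsNoetherianRing S] [IsArtinianRing S]

lemma FixedBy.supp_dual_subset (hF : D.FixedBy F) (X : FGModuleCat.{u} S) :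
    D.supp (F.dualObj X) ⊆ D.supp X :=
  D.devissage (motive := fun Y => D.supp (F.dualObj Y) ⊆ D.supp X)
    (fun Y _ => by
      have := F.subsingleton_dual Y
      rw [D.supp_eq_empty]
      exact Set.empty_subset _)
    (fun f g h hA hC => by
      have h' := F.isShortExact_dual h
      exact (D.supp_subset_union h'.injective h'.exact).trans (Set.union_subset hC hA))
    X fun l hl m hm => by
      obtain ⟨e⟩ := hF l
      rw [D.supp_congr e] at hm
      rwa [D.eq_of_mem_supp_L hm]

end SimplesWithCovers

/-! ### Standard modules of quasi-hereditary algebras -/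

/-- The short exact sequence attached to a section `B / A` of a filtration. -/
lemma isShortExact_section {S : Type u} [Ring S] [IsNoetherianRing S] {M C : FGModuleCat.{u} S}
    {A B : Submodule S M} (hAB : A ≤ B) (e : (B ⧸ A.comap B.subtype) ≃ₗ[S] C) :
    IsShortExact (A := FGModuleCat.of S A) (B := FGModuleCat.of S B) (Submodule.inclusion hAB)
      (e.toLinearMap ∘ₗ Submodule.mkQ _) where
  injective := Submodule.inclusion_injective hAB
  exact y := by
    have h : (e.toLinearMap ∘ₗ Submodule.mkQ (A.comap B.subtype)) y = 0 ↔ (y : B).1 ∈ A := by simp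
    rw [h]
    exact ⟨fun hy => ⟨⟨_, hy⟩, rfl⟩, fun ⟨x, hx⟩ => hx ▸ x.2⟩
  surjective := e.surjective.comp (Submodule.mkQ_surjective _)

namespace SimplesWithCovers

variable {S : Type u} [Ring S] {Λ : Type w} [PartialOrder Λ] (D : SimplesWithCovers S Λ)

lemma supp_standard (l : Λ) : D.supp (D.standard l) ⊆ Set.Iic l := by
  rintro m ⟨φ, hφ⟩
  by_contra hm
  refine hφ (LinearMap.ext fun x => ?_)
  obtain ⟨y, hy⟩ := (D.standardKernel l).mkQ_surjective (φ x)
  have hmem : y ∈ D.standardKernel l := by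
    refine (Submodule.mem_sInf).mpr fun U hU => ?_
    have hle : D.standardKernel l ≤ U := sInf_le hU
    have h0 : Submodule.factor hle ∘ₗ φ = 0 := D.eq_zero_of_notMem_supp
      (fun h => hm (hU m (D.isCompositionFactor_of_mem_supp h))) _
    have h1 : Submodule.factor hle (φ x) = 0 := LinearMap.congr_fun h0 x
    rw [← hy] at h1
    exact (Submodule.Quotient.mk_eq_zero U).mp h1
  rw [← hy]
  exact (Submodule.Quotient.mk_eq_zero _).mpr hmem

lemma standardKernel_le (l : Λ) : D.standardKernel l ≤ LinearMap.ker (D.π l) := by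
  refine sInf_le fun m hm => ?_
  have h := D.mem_supp_of_isCompositionFactor hm
  rw [D.supp_congr (LinearMap.quotKerEquivOfSurjective _ (D.surjective_π l))] at h
  exact (D.eq_of_mem_supp_L h).le

/-- The projection of a standard module onto its simple head. -/
noncomputable def toHead (l : Λ) : D.standard l →ₗ[S] D.L l :=
  (D.standardKernel l).liftQ (D.π l) (D.standardKernel_le l)

lemma toHead_surjective (l : Λ) : Function.Surjective (D.toHead l) := fun y => by
  obtain ⟨x, rfl⟩ := D.surjective_π l y
  exact ⟨(D.standardKernel l).mkQ x, rfl⟩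

/-- The radical of the standard module `Δ l`, the kernel of `Δ l → L l`. -/
noncomputable abbrev rad (l : Λ) : Submodule S (D.standard l) := LinearMap.ker (D.toHead l)

lemma isCoatom_rad (l : Λ) : IsCoatom (D.rad l) :=
  have := D.simple_L l
  LinearMap.isCoatom_ker_of_surjective (D.toHead_surjective l)

/-- Every proper submodule of `Δ l` lies in its radical. -/
lemma le_rad {l : Λ} {N : Submodule S (D.standard l)} (hN : N ≠ ⊤) : N ≤ D.rad l := by
  have h : N.comap (D.standardKernel l).mkQ ≤ LinearMap.ker (D.π l) := by
    refine D.le_ker_π fun h => hN ?_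
    rw [eq_top_iff]
    intro x _
    obtain ⟨y, rfl⟩ := (D.standardKernel l).mkQ_surjective x
    have : y ∈ N.comap (D.standardKernel l).mkQ := h ▸ Submodule.mem_top
    exact this
  intro x hx
  obtain ⟨y, rfl⟩ := (D.standardKernel l).mkQ_surjective x
  exact h hx

variable {D} [IsNoetherianRing S]

/-- `Δ l` is the quotient of `P l` by a submodule with a filtration whose sections are `Δ m` with
`l < m`, so that the vanishing of `Ext` is inherited from these. -/
lemma IsQuasiHereditary.exists_presentation (hD : D.IsQuasiHereditary) (l : Λ) :
    ∃ (K : FGModuleCat.{u} S) (f : K →ₗ[S] D.P l) (g : D.P l →ₗ[S] D.standard l),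
      IsShortExact f g ∧ ∀ (X : FGModuleCat.{u} S) (i : ℕ),
        (∀ m, l < m → ExtVanishes (D.standard m) X i) → ExtVanishes K X i := by
  obtain ⟨r, F, ν, h0, h1, hle, hsec, ⟨t, ht, huniq⟩, hν⟩ := hD.filtration l
  obtain _ | r := r
  · exact t.elim0
  -- the top section is a quotient of `P l`, so it is `Δ l`
  have htop : F (Fin.last r).succ = ⊤ := by rw [Fin.succ_last]; exact h1
  obtain ⟨e⟩ := hsec (Fin.last r)
  have hlast : ν (Fin.last r) = l := by
    let q : D.P l →ₗ[S] D.L (ν (Fin.last r)) := D.toHead _ ∘ₗ e.toLinearMap ∘ₗ Submodule.mkQ _ ∘ₗ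
      (LinearEquiv.ofTop _ htop).symm.toLinearMap
    have hq : Function.Surjective q := (D.toHead_surjective _).comp (e.surjective.comp
      ((Submodule.mkQ_surjective _).comp (LinearEquiv.ofTop _ htop).symm.surjective))
    refine (D.eq_of_mem_supp_L (m := l) ⟨q, fun h => ?_⟩).symm
    refine D.π_ne_zero (ν (Fin.last r)) (LinearMap.ext fun x => ?_)
    obtain ⟨y, hy⟩ := hq (D.π _ x)
    rw [← hy, h]
    rfl
  have hlt : ∀ j : Fin r, l < ν j.castSucc := fun j =>
    lt_of_le_of_ne (hν _) fun h => by
      have h2 := (huniq _ h.symm).trans (huniq _ hlast).symm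
      exact (Fin.castSucc_lt_last j).ne h2
  rw [hlast] at e
  have hses := isShortExact_section (M := D.P l) (hle (Fin.last r)) e
  refine ⟨FGModuleCat.of S (F (Fin.last r).castSucc), Submodule.subtype _,
    (e.toLinearMap ∘ₗ Submodule.mkQ _) ∘ₗ (LinearEquiv.ofTop _ htop).symm.toLinearMap,
    ⟨Submodule.subtype_injective _, fun y => ?_,
      hses.surjective.comp (LinearEquiv.ofTop _ htop).symm.surjective⟩, fun X i hX => ?_⟩
  · refine (hses.exact ((LinearEquiv.ofTop _ htop).symm y)).trans ?_
    constructor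
    · rintro ⟨x, hx⟩
      exact ⟨x, congrArg Subtype.val hx⟩
    · rintro ⟨x, hx⟩
      exact ⟨x, Subtype.ext hx⟩
  · have key : ∀ j : Fin (r + 1), ExtVanishes (FGModuleCat.of S (F j.castSucc)) X i := by
      intro j
      induction j using Fin.induction with
      | zero =>
        have : Subsingleton (FGModuleCat.of S (F (Fin.castSucc 0))) := by
          rw [Fin.castSucc_zero, h0]
          exact inferInstanceAs (Subsingleton (⊥ : Submodule S (D.P l)))
        exact extVanishes_of_subsingleton_left i
      | succ j ih =>
        obtain ⟨e'⟩ := hsec j.castSucc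
        have hses' := isShortExact_section (M := D.P l) (hle j.castSucc) e'
        exact hses'.ext_middle_left ih (hX _ (hlt j))
    exact key _

/-- `Δ l` behaves like a projective module towards modules without composition factors above
`l`. -/
lemma IsQuasiHereditary.extVanishes_standard (hD : D.IsQuasiHereditary) (i : ℕ) :
    ∀ (l : Λ) (X : FGModuleCat.{u} S), (∀ m ∈ D.supp X, ¬ l < m) →
      ExtVanishes (D.standard l) X (i + 1) := by
  induction i with
  | zero =>
    intro l X hX
    obtain ⟨K, f, g, h, hK⟩ := hD.exists_presentation l
    have := D.projective_P l
    refine h.ext_right_left (hK X 0 fun m hm => ?_) (extVanishes_of_projective 0)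
    rw [extVanishes_zero_iff]
    refine subsingleton_of_forall_eq 0 fun φ => LinearMap.ext fun x => ?_
    obtain ⟨y, rfl⟩ := (D.standardKernel m).mkQ_surjective x
    exact LinearMap.congr_fun (D.eq_zero_of_notMem_supp (fun hmX => hX m hmX hm)
      (φ ∘ₗ (D.standardKernel m).mkQ)) y
  | succ i ih =>
    intro l X hX
    obtain ⟨K, f, g, h, hK⟩ := hD.exists_presentation l
    have := D.projective_P l
    exact h.ext_right_left
      (hK X (i + 1) fun m hm => ih m X fun m' hm' h' => hX m' hm' (hm.trans h'))
      (extVanishes_of_projective (i + 1))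

variable [IsArtinianRing S]

/-- The composition factors of the radical of `Δ l` are of the form `L m` with `m < l`. -/
lemma IsQuasiHereditary.supp_rad (hD : D.IsQuasiHereditary) (l : Λ) :
    D.supp (D.rad l) ⊆ Set.Iio l := by
  suffices h : l ∉ D.supp (D.rad l) from fun m hm => lt_of_le_of_ne
    (D.supp_standard l (D.supp_subset_of_injective (D.rad l).subtype_injective hm))
    fun hml => h (hml ▸ hm)
  obtain ⟨s, h0, h1⟩ := exists_compositionSeries_of_isNoetherian_isArtinian S (D.standard l)
  obtain ⟨i, hi, huniq⟩ := hD.occursOnce l s h0 h1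
  have hpos : 0 < s.length := i.pos
  -- the penultimate term of the composition series is the radical
  let t : Fin s.length := ⟨s.length - 1, by omega⟩
  have htlast : t.succ = Fin.last s.length := Fin.ext (by simp [t]; omega)
  have hst : s t.succ = ⊤ := by rw [htlast]; exact h1
  have hrad : s t.castSucc = D.rad l := by
    have hc : IsCoatom (s t.castSucc) := by
      rw [← covBy_top_iff, ← hst]
      exact s.step t
    exact (hc.le_iff_eq (D.isCoatom_rad l).1).mp (D.le_rad hc.1) |>.symm
  have ht : t = i := by
    refine huniq t ?_
    beta_reduce
    rw [hst, hrad]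
    refine ⟨Submodule.Quotient.equiv _ _ Submodule.topEquiv ?_ ≪≫ₗ
      LinearMap.quotKerEquivOfSurjective _ (D.toHead_surjective l)⟩
    ext x
    simp
  have key : ∀ (j : ℕ) (hj : j < s.length), l ∉ D.supp (s ⟨j, by omega⟩) := by
    intro j
    induction j with
    | zero =>
      intro hj hl
      have hbot : s ⟨0, by omega⟩ = ⊥ := h0
      rw [hbot, D.supp_eq_empty] at hl
      exact hl
    | succ j ih =>
      intro hj hl
      let a : Fin s.length := ⟨j, by omega⟩
      have hcov : s a.castSucc ⋖ s a.succ := s.step a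
      have hsimple := (covBy_iff_quot_is_simple hcov.le).mp hcov
      obtain ⟨m, ⟨e⟩⟩ := D.exists_iso
        (FGModuleCat.of S (s a.succ ⧸ (s a.castSucc).comap (s a.succ).subtype)) hsimple
      have hml : m ≠ l := by
        rintro rfl
        have : a = t := (huniq a ⟨e⟩).trans ht.symm
        have := congrArg Fin.val this
        simp only [a, t] at this
        omega
      have hses := isShortExact_section hcov.le e
      rcases D.supp_subset_union hses.injective hses.exact hl with h | h
      · exact ih (by omega) h
      · exact hml (D.eq_of_mem_supp_L h).symm
  have := key (s.length - 1) (by omega)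
  rwa [← hrad]

/-- The module `∇ m := (Δ m)°` is the costandard module, and `Ext^i(Δ l, ∇ m)` vanishes for
`i > 0`. -/
lemma IsQuasiHereditary.extVanishes_standard_dual (hD : D.IsQuasiHereditary)
    {F : ModuleDuality S} (hF : D.FixedBy F) (i : ℕ) (l m : Λ) :
    ExtVanishes (D.standard l) (F.dualObj (D.standard m)) (i + 1) := by
  by_cases hlm : l < m
  · -- the inverse duality exchanges the roles of `l` and `m`
    obtain ⟨e⟩ := F.nonempty_dual_inv (D.standard l)
    rw [← ExtVanishes.congr_left e, F.extVanishes_dual_iff]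
    exact hD.extVanishes_standard i m _ fun m' hm' h => hlm.not_ge
      (h.le.trans (D.supp_standard l (hF.inv.supp_dual_subset _ hm')))
  · exact hD.extVanishes_standard i l _ fun m' hm' h => hlm
      (h.trans_le (D.supp_standard m (hF.supp_dual_subset _ hm')))

end SimplesWithCovers

/-! ### The `∇`-filtration dimension and Yoneda products -/

namespace SimplesWithCovers

variable {S : Type u} [Ring S] {Λ : Type w} [PartialOrder Λ] {D : SimplesWithCovers S Λ}

lemma gfd_lt_iff {X : FGModuleCat.{u} S} {n : ℕ} :
    D.gfd X < n ↔ ∀ i, n ≤ i → ∀ l, ExtVanishes (D.standard l) X i := by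
  refine ⟨fun h i hi l => ?_, fun h => sInf_lt_iff.2 ?_⟩
  · have hmem : D.gfd X ∈ _ := csInf_mem ⟨⊤, by simp⟩
    simp only [Set.mem_ofPred_eq] at hmem
    exact hmem i (h.trans_le (by exact_mod_cast hi)) l
  · obtain _ | n := n
    · exact ⟨⊥, fun i _ => h i (Nat.zero_le i), by decide⟩
    · exact ⟨n, fun i hi => h i (by simpa using hi), by simp [ENat.WithBot.lt_add_one_iff]⟩

lemma extVanishes_of_gfd_le {X : FGModuleCat.{u} S} {n i : ℕ} (h : D.gfd X ≤ n) (hi : n < i)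
    (l : Λ) : ExtVanishes (D.standard l) X i :=
  gfd_lt_iff.mp (h.trans_lt (by exact_mod_cast hi)) i le_rfl l

lemma exists_gfd_eq {n : ℕ} (hn : D.gfdAlgebra = n) : ∃ Q : FGModuleCat.{u} S, D.gfd Q = n := by
  by_contra! h
  have hlt : ∀ X, D.gfd X < n := fun X => lt_of_le_of_ne (hn ▸ le_iSup D.gfd X) (h X)
  have : D.gfdAlgebra < n := by
    obtain _ | n := n
    · refine lt_of_le_of_lt (iSup_le fun X => ?_) (by decide : (⊥ : WithBot ℕ∞) < ((0 : ℕ) : _))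
      exact ((WithBot.lt_zero_iff_eq_bot _).mp (by simpa using hlt X)).le
    · refine lt_of_le_of_lt (b := (n : WithBot ℕ∞)) (iSup_le fun X => ?_)
        (by simp [ENat.WithBot.lt_add_one_iff])
      exact ENat.WithBot.lt_add_one_iff.mp (by simpa using hlt X)
  exact this.ne hn

/-- If the `∇`-filtration dimensions of the simple modules are finite, then strong property A gives
a strictly monotone function on the labels. -/
lemma exists_strictMono_of_gfd (hA : ∀ m l : Λ, m < l → D.gfd (D.L m) < D.gfd (D.L l))
    {n : ℕ} (hn : ∀ X, D.gfd X ≤ n) : ∃ d : Λ → ℕ, StrictMono d ∧ ∀ l, d l ≤ n := by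
  have hex : ∀ l, ∃ d : ℕ, D.gfd (D.L l) = d := by
    intro l
    have hle := hn (D.L l)
    have h0 : ¬ D.gfd (D.L l) < (0 : ℕ) := fun h => by
      have hv := extVanishes_zero_iff.mp (gfd_lt_iff.mp h 0 le_rfl l)
      refine D.π_ne_zero l (LinearMap.ext fun x => ?_)
      exact LinearMap.congr_fun (Subsingleton.elim (D.toHead l) 0) ((D.standardKernel l).mkQ x)
    generalize D.gfd (D.L l) = x at hle h0
    induction x with
    | bot => exact absurd (by decide) h0
    | coe a =>
      induction a with
      | top => exact absurd hle (not_le.mpr (WithBot.coe_lt_coe.mpr (ENat.natCast_lt_top n)))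
      | coe a => exact ⟨a, rfl⟩
  choose d hd using hex
  refine ⟨d, fun m l hml => ?_, fun l => ?_⟩
  · have := hA m l hml
    rw [hd, hd] at this
    exact_mod_cast this
  · have := hn (D.L l)
    rw [hd] at this
    exact_mod_cast this

section

variable [IsNoetherianRing S] [IsArtinianRing S] {d : Λ → ℕ}

/-- The simple module `L l` has an exact sequence `0 → rad Δ l → Δ l → L l → 0`, along which the
vanishing of `Ext(Δ m, Y)` above degree `b` propagates to `Ext(L l, Y)` above degree `d l + b`. -/
lemma IsQuasiHereditary.extVanishes_L_left (hD : D.IsQuasiHereditary) (hd : StrictMono d)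
    {Y : FGModuleCat.{u} S} {b : ℕ} (hY : ∀ l i, b < i → ExtVanishes (D.standard l) Y i) (i : ℕ) :
    ∀ l, d l + b < i → ExtVanishes (D.L l) Y i := by
  induction i with
  | zero => intro l hl; omega
  | succ i ih =>
    intro l hl
    refine (isShortExact_ker (D.toHead_surjective l)).ext_right_left
      (D.extVanishes_left_of_supp fun m hm => ih m ?_) (hY l _ (by omega))
    have := hd (hD.supp_rad l hm)
    omega

/-- The dual exact sequence `0 → L l → ∇ l → (rad Δ l)° → 0` bounds the degrees in which
`Ext(Δ m, L l)` is non-zero. -/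
lemma IsQuasiHereditary.extVanishes_L_right (hD : D.IsQuasiHereditary) (hd : StrictMono d)
    {F : ModuleDuality S} (hF : D.FixedBy F) (m : Λ) (i : ℕ) :
    ∀ l, d l < i + d m → ExtVanishes (D.standard m) (D.L l) i := by
  induction i with
  | zero =>
    intro l hl
    rw [extVanishes_zero_iff]
    refine subsingleton_of_forall_eq 0 fun φ => LinearMap.ext fun x => ?_
    obtain ⟨y, rfl⟩ := (D.standardKernel m).mkQ_surjective x
    refine LinearMap.congr_fun (D.eq_zero_of_notMem_supp (fun h => ?_)
      (φ ∘ₗ (D.standardKernel m).mkQ)) y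
    have := D.eq_of_mem_supp_L h
    subst this
    omega
  | succ i ih =>
    intro l hl
    obtain ⟨e⟩ := hF l
    rw [← ExtVanishes.congr_right e]
    refine (F.isShortExact_dual (isShortExact_ker (D.toHead_surjective l))).ext_left_right
      (D.extVanishes_right_of_supp fun l' hl' => ih l' ?_)
      (hD.extVanishes_standard_dual hF i m l)
    have := hd (hD.supp_rad l (hF.supp_dual_subset _ hl'))
    omega

/-- A standard module `Δ m` with `d m = 0` is simple. -/
lemma IsQuasiHereditary.nonempty_standard_equiv_L (hD : D.IsQuasiHereditary) (hd : StrictMono d)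
    {m : Λ} (hm : d m = 0) : Nonempty (D.standard m ≃ₗ[S] D.L m) := by
  have hs : Subsingleton (FGModuleCat.of S (D.rad m)) :=
    D.subsingleton_of_supp_eq_empty (Set.eq_empty_of_forall_notMem fun l hl => by
      have := hd (hD.supp_rad m hl)
      omega)
  refine ⟨LinearEquiv.ofBijective (D.toHead m) ⟨?_, D.toHead_surjective m⟩⟩
  rw [← LinearMap.ker_eq_bot]
  exact (Submodule.subsingleton_iff_eq_bot).mp hs

/-- A module whose composition factors `L l` satisfy `d l ≤ e + 1` receives a map from a direct sum
`Y` of standard modules `Δ l` with `d l = e + 1`, whose kernel and cokernel only have composition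
factors with `d l ≤ e`. The shape of `Y` is recorded only through the vanishing of `Ext` groups
that it inherits from these `Δ l`. -/
lemma IsQuasiHereditary.exists_standard_approximation (hD : D.IsQuasiHereditary)
    (hd : StrictMono d) (e : ℕ) {X : FGModuleCat.{u} S} (hX : ∀ l ∈ D.supp X, d l ≤ e + 1) :
    ∃ (Y : FGModuleCat.{u} S) (f : Y →ₗ[S] X),
      (∀ (Z : FGModuleCat.{u} S) (i : ℕ),
        (∀ l, d l = e + 1 → ExtVanishes (D.standard l) Z i) → ExtVanishes Y Z i) ∧
      (∀ l ∈ D.supp (LinearMap.ker f), d l ≤ e) ∧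
      (∀ l ∈ D.supp (X ⧸ LinearMap.range f), d l ≤ e) := by
  -- choose the map with the largest possible image
  obtain ⟨N, ⟨Y, f, hY, hker, rfl⟩, hmax⟩ := WellFounded.has_min
    (wellFounded_gt (α := Submodule S X))
    {N | ∃ (Y : FGModuleCat.{u} S) (f : Y →ₗ[S] X),
      (∀ (Z : FGModuleCat.{u} S) (i : ℕ),
        (∀ l, d l = e + 1 → ExtVanishes (D.standard l) Z i) → ExtVanishes Y Z i) ∧
      (∀ l ∈ D.supp (LinearMap.ker f), d l ≤ e) ∧ LinearMap.range f = N}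
    (by
      have : Subsingleton (FGModuleCat.of S PUnit.{u + 1}) := inferInstanceAs (Subsingleton PUnit)
      refine ⟨⊥, FGModuleCat.of S PUnit, 0, fun Z i _ => extVanishes_of_subsingleton_left i,
        fun l hl => ?_, LinearMap.range_zero⟩
      rw [D.supp_eq_empty] at hl
      exact hl.elim)
  refine ⟨Y, f, hY, hker, fun l hl => ?_⟩
  by_contra hle
  have hdl : d l = e + 1 :=
    le_antisymm (hX l (D.supp_subset_of_surjective (Submodule.mkQ_surjective _) hl)) (by omega)
  obtain ⟨φ, hφ⟩ := hl
  have := D.projective_P l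
  obtain ⟨φ', hφ'⟩ :=
    Module.projective_lifting_property (LinearMap.range f).mkQ φ (Submodule.mkQ_surjective _)
  -- `φ'` factors through `Δ l`, as `X` has no composition factors above `l`
  obtain ⟨K, f₀, g₀, h₀, hK⟩ := hD.exists_presentation l
  have hKX : Subsingleton (K →ₗ[S] X) := by
    refine extVanishes_zero_iff.mp (hK X 0 fun m hm => ?_)
    rw [extVanishes_zero_iff]
    refine subsingleton_of_forall_eq 0 fun ψ => LinearMap.ext fun x => ?_
    obtain ⟨y, rfl⟩ := (D.standardKernel m).mkQ_surjective x
    refine LinearMap.congr_fun (D.eq_zero_of_notMem_supp (fun h => ?_)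
      (ψ ∘ₗ (D.standardKernel m).mkQ)) y
    have := hd hm
    have := hX m h
    omega
  have hkerle : LinearMap.ker g₀ ≤ LinearMap.ker φ' := fun x hx => by
    obtain ⟨a, rfl⟩ := (h₀.exact x).mp hx
    exact LinearMap.congr_fun (Subsingleton.elim (φ' ∘ₗ f₀) 0) a
  let γ : D.standard l →ₗ[S] X := (LinearMap.ker g₀).liftQ φ' hkerle ∘ₗ
    (LinearMap.quotKerEquivOfSurjective g₀ h₀.surjective).symm.toLinearMap
  have hγ : (LinearMap.range f).mkQ ∘ₗ γ ≠ 0 := fun h => hφ (LinearMap.ext fun x => by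
    have h1 := LinearMap.congr_fun h (LinearMap.quotKerEquivOfSurjective g₀ h₀.surjective
      (Submodule.Quotient.mk x))
    have h2 := LinearMap.congr_fun hφ' x
    simp only [γ, LinearMap.comp_apply, LinearEquiv.coe_coe, LinearEquiv.symm_apply_apply,
      Submodule.liftQ_apply, LinearMap.zero_apply] at h1 h2 ⊢
    rw [← h2, h1])
  refine hmax (LinearMap.range (f.coprod γ)) ⟨FGModuleCat.of S (Y × D.standard l), f.coprod γ,
    fun Z i hZ => ?_, fun m hm => ?_, rfl⟩ ?_
  · have h : IsShortExact (A := Y) (B := FGModuleCat.of S (Y × D.standard l))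
        (LinearMap.inl S Y (D.standard l)) (LinearMap.snd S Y (D.standard l)) :=
      ⟨LinearMap.inl_injective, Function.Exact.inl_snd, LinearMap.snd_surjective⟩
    exact h.ext_middle_left (hY Z i hZ) (hZ l hdl)
  · by_contra hme
    obtain ⟨ψ, hψ⟩ := hm
    -- the component of `ψ` in `Δ l` lands in the radical, so it vanishes
    have hrad : ∀ x, (ψ x).1.2 ∈ D.rad l := fun x => by
      refine D.le_rad (N := LinearMap.ker ((LinearMap.range f).mkQ ∘ₗ γ))
        (fun h => hγ (LinearMap.ker_eq_top.mp h)) ?_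
      have hx : f (ψ x).1.1 + γ (ψ x).1.2 = 0 := (ψ x).2
      have : γ (ψ x).1.2 = f (-(ψ x).1.1) := by
        rw [map_neg, eq_neg_iff_add_eq_zero, add_comm, hx]
      rw [LinearMap.mem_ker, LinearMap.comp_apply, this]
      exact (Submodule.Quotient.mk_eq_zero _).mpr (LinearMap.mem_range_self f _)
    have h2 : ∀ x, (ψ x).1.2 = 0 := fun x => by
      have h := D.eq_zero_of_notMem_supp (X := D.rad l) (m := m)
        (fun h => hme (by have := hd (hD.supp_rad l h); omega))
        ((LinearMap.snd S Y (D.standard l) ∘ₗ Submodule.subtype _ ∘ₗ ψ).codRestrict _ hrad)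
      exact congrArg Subtype.val (LinearMap.congr_fun h x)
    have h1k : ∀ x, (ψ x).1.1 ∈ LinearMap.ker f := fun x => by
      have hx : f (ψ x).1.1 + γ (ψ x).1.2 = 0 := (ψ x).2
      rwa [h2, map_zero, add_zero] at hx
    have h1 : ∀ x, (ψ x).1.1 = 0 := fun x => by
      have h := D.eq_zero_of_notMem_supp (X := LinearMap.ker f) (m := m)
        (fun h => hme (hker m h))
        ((LinearMap.fst S Y (D.standard l) ∘ₗ Submodule.subtype _ ∘ₗ ψ).codRestrict _ h1k)
      exact congrArg Subtype.val (LinearMap.congr_fun h x)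
    exact hψ (LinearMap.ext fun x => Subtype.ext (Prod.ext (h1 x) (h2 x)))
  · rw [LinearMap.range_coprod]
    refine lt_of_le_of_ne le_sup_left fun h => hγ (LinearMap.ext fun x => ?_)
    have : γ x ∈ LinearMap.range f :=
      h ▸ (le_sup_right : LinearMap.range γ ≤ _) (LinearMap.mem_range_self γ x)
    exact (Submodule.Quotient.mk_eq_zero _).mpr this

open Abelian

/-- Yoneda multiplication with a non-zero class in `Ext^n(L ν, Q)`, where `d ν = 0` and `n` is the
largest value that `d` may take, is injective on `Ext^e(X, L ν)` when the composition factors `L l`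
of `X` satisfy `d l ≤ e`. -/
theorem IsQuasiHereditary.eq_zero_of_comp_eq_zero (hD : D.IsQuasiHereditary) (hd : StrictMono d)
    {F : ModuleDuality S} (hF : D.FixedBy F) {n : ℕ} (hn : ∀ l, d l ≤ n) {ν : Λ} (hν : d ν = 0)
    {Q : FGModuleCat.{u} S} {α : Ext (D.L ν).obj Q.obj n} (hα : α ≠ 0) (e : ℕ) :
    ∀ (X : FGModuleCat.{u} S), (∀ l ∈ D.supp X, d l ≤ e) → ∀ (x : Ext X.obj (D.L ν).obj e) {c : ℕ}
      (h : e + n = c), x.comp α h = 0 → x = 0 := by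
  induction e with
  | zero =>
    intro X hX x c hc hx
    obtain ⟨φ, rfl⟩ := Ext.homEquiv₀.symm.surjective x
    rw [Ext.homEquiv₀_symm_apply] at hx ⊢
    by_contra hne
    have := D.simple_L ν
    have hs : Function.Surjective φ.hom := LinearMap.surjective_of_ne_zero fun h => hne (by
      rw [show φ = 0 from ModuleCat.hom_ext h, Ext.mk₀_zero])
    -- there are no extensions between simple modules with `d l = 0`, so `φ` splits
    have hZ : ∀ Z : FGModuleCat.{u} S, (∀ l ∈ D.supp Z, d l ≤ 0) → ExtVanishes (D.L ν) Z 1 := by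
      intro Z hZ
      obtain ⟨i⟩ := hD.nonempty_standard_equiv_L hd hν
      rw [← ExtVanishes.congr_left i]
      refine D.extVanishes_right_of_supp fun l hl => hD.extVanishes_L_right hd hF ν 1 l ?_
      have := hZ l hl
      omega
    have hses := isShortExact_ker (B := X) (C := D.L ν) hs
    obtain ⟨s, hs'⟩ := (hses.ext_one_right_iff (hZ X hX)).mp
      (hZ _ fun l hl => hX l (D.supp_subset_of_injective (Submodule.subtype_injective _) hl))
      LinearMap.id
    have hid : 𝟙 (D.L ν).obj = (ModuleCat.ofHom s : (D.L ν).obj ⟶ X.obj) ≫ φ :=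
      ModuleCat.hom_ext hs'.symm
    obtain rfl : c = n := by omega
    refine hα ?_
    rw [← α.mk₀_id_comp, hid, ← Ext.mk₀_comp_mk₀_assoc, hx, Ext.comp_zero]
  | succ e ih =>
    intro X hX x c hc hx
    obtain ⟨Y, f, hY, hker, hcoker⟩ := hD.exists_standard_approximation hd e hX
    have hYν : ExtVanishes Y (D.L ν) (e + 1) :=
      hY _ _ fun l hl => hD.extVanishes_L_right hd hF l _ ν (by omega)
    have hYQ : ExtVanishes Y Q (e + n) := hY _ _ fun l hl =>
      D.extVanishes_right_of_supp fun m _ => hD.extVanishes_L_right hd hF l _ m (by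
        have := hn m
        omega)
    have hses₁ := isShortExact_ker (B := Y) (C := FGModuleCat.of S (LinearMap.range f))
      f.surjective_rangeRestrict
    have hses₂ := isShortExact_submodule (LinearMap.range f)
    -- `x` restricts to zero on the image of `Y`: as `Ext^(e + 1)(Y, L ν) = 0`, the restriction
    -- comes from a class `z` on the kernel, to which the induction hypothesis applies because
    -- `Ext^(e + n)(Y, Q) = 0`
    have hx' : (Ext.mk₀ hses₂.complex.f).comp x (zero_add _) = 0 := by
      obtain ⟨z, hz⟩ := Ext.contravariant_sequence_exact₃ hses₁.shortExact (D.L ν).obj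
        ((Ext.mk₀ hses₂.complex.f).comp x (zero_add _)) (@Subsingleton.elim _ hYν _ _)
        (add_comm 1 e)
      have hzα : hses₁.shortExact.extClass.comp (z.comp α rfl) (by omega : 1 + (e + n) = c) = 0 := by
        rw [← Ext.comp_assoc _ _ _ (add_comm 1 e) rfl (by omega), hz,
          Ext.comp_assoc _ _ _ _ hc (by omega), hx, Ext.comp_zero]
      obtain ⟨y, hy⟩ := Ext.contravariant_sequence_exact₁ hses₁.shortExact Q.obj
        (z.comp α rfl) (by omega : 1 + (e + n) = c) hzα
      rw [@Subsingleton.elim _ hYQ y 0, Ext.comp_zero] at hy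
      rw [← hz, ih (FGModuleCat.of S (LinearMap.ker f.rangeRestrict)) ?_ z rfl hy.symm,
        Ext.comp_zero]
      intro l hl
      rw [LinearMap.ker_rangeRestrict] at hl
      exact hker l hl
    -- hence `x` comes from the cokernel, where `Ext^(e + 1)(-, L ν)` vanishes for degree reasons
    obtain ⟨y, rfl⟩ := Ext.contravariant_sequence_exact₂ hses₂.shortExact (D.L ν).obj x hx'
    have hc : ExtVanishes (FGModuleCat.of S (X ⧸ LinearMap.range f)) (D.L ν) (e + 1) :=
      D.extVanishes_left_of_supp fun l hl => hD.extVanishes_L_left hd (b := 0)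
        (fun m i hi => hD.extVanishes_L_right hd hF m i ν (by omega)) _ l
        (by have := hcoker l hl; omega)
    rw [@Subsingleton.elim _ hc y 0, Ext.comp_zero]

end

end SimplesWithCovers

theorem theorem2p2p1 {k : Type*} [Field k] {S : Type u} [Ring S] [Algebra k S]
    [Module.Finite k S] {Λ : Type w} [PartialOrder Λ] (D : SimplesWithCovers S Λ)
    (hqh : D.IsQuasiHereditary)
    (dual : (FGModuleCat.{u} S)ᵒᵖ ≌ FGModuleCat.{u} S)
    (hdual : ∀ l : Λ, Nonempty (dual.functor.obj (Opposite.op (D.L l)) ≅ D.L l))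
    (hA : ∀ m l : Λ, m < l → D.gfd (D.L m) < D.gfd (D.L l))
    (n : ℕ) (hn : D.gfdAlgebra = n) :
    globalDim S = (2 * n : ℕ) ∧
      ∀ Q : FGModuleCat.{u} S, D.gfd Q = n →
        Nontrivial (Abelian.Ext (dual.functor.obj (Opposite.op Q)).obj Q.obj (2 * n)) := by
  have : IsNoetherianRing S := isNoetherian_of_tower k inferInstance
  have : IsArtinianRing S := isArtinian_of_tower k inferInstance
  have hF : D.FixedBy dual := fun l => (hdual l).map FGModuleCat.isoToLinearEquiv
  have hle : ∀ X, D.gfd X ≤ n := fun X => hn ▸ le_iSup D.gfd X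
  obtain ⟨d, hd, hdn⟩ := SimplesWithCovers.exists_strictMono_of_gfd hA hle
  have hQ : ∀ Q : FGModuleCat.{u} S, D.gfd Q = n →
      Nontrivial (Abelian.Ext (dual.functor.obj (Opposite.op Q)).obj Q.obj (2 * n)) := by
    intro Q hQ
    obtain ⟨ν, hν⟩ : ∃ ν, ¬ ExtVanishes (D.standard ν) Q n := by
      by_contra! h
      refine hQ.not_lt (SimplesWithCovers.gfd_lt_iff.mpr fun i hi l => ?_)
      obtain rfl | hi := hi.eq_or_lt
      · exact h l
      · exact SimplesWithCovers.extVanishes_of_gfd_le hQ.le hi l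
    -- `Ext^n(Δ ν, L l) ≠ 0` for some `l`, and then `n + d ν ≤ d l ≤ n`
    have hν0 : d ν = 0 := by
      by_contra h0
      exact hν (D.extVanishes_right_of_supp fun l _ =>
        hqh.extVanishes_L_right hd hF ν n l (by have := hdn l; omega))
    obtain ⟨e⟩ := hqh.nonempty_standard_equiv_L hd hν0
    rw [ExtVanishes.congr_left e] at hν
    have hν' : ¬ ExtVanishes (ModuleDuality.dualObj dual Q) (D.L ν) n := by
      obtain ⟨e'⟩ := hF ν
      rwa [← ExtVanishes.congr_right e', ModuleDuality.extVanishes_dual_iff]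
    obtain ⟨α, hα⟩ := @exists_ne _ (not_subsingleton_iff_nontrivial.mp hν) 0
    obtain ⟨x, hx⟩ := @exists_ne _ (not_subsingleton_iff_nontrivial.mp hν') 0
    exact ⟨x.comp α (two_mul n).symm, 0, fun h => hx
      (hqh.eq_zero_of_comp_eq_zero hd hF hdn hν0 hα n _ (fun l _ => hdn l) x _ h)⟩
  refine ⟨le_antisymm (iSup_le fun X => ?_) ?_, hQ⟩
  · rw [projectiveDimension_le_iff]
    refine hasProjectiveDimensionLT_of_extVanishes _ X fun Y =>
      D.extVanishes_left_of_supp fun l _ => hqh.extVanishes_L_left hd (b := n)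
        (fun m i hi => SimplesWithCovers.extVanishes_of_gfd_le (hle Y) hi m) _ l
        (by have := hdn l; omega)
  · obtain ⟨Q, hQn⟩ := SimplesWithCovers.exists_gfd_eq hn
    refine le_iSup_of_le (dual.functor.obj (Opposite.op Q)) ?_
    rw [projectiveDimension_ge_iff]
    intro h
    exact not_subsingleton_iff_nontrivial.mpr (hQ Q hQn)
      (h.subsingleton _ _ _ le_rfl _)
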